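/- A $\{0,1\}$-lattice is a lattice with least element $0$ and greatest element $1$, $0\neq 1$; its homomorphisms and sublattices are required to preserve, respectively contain, $0$ and $1$. Call a countable $\{0,1\}$-lattice $K$ \emph{typical} (a Fraïssé limit of the class of finite $\{0,1\}$-lattices) if it is locally finite (every finite subset of $K$ is contained in a finite $\{0,1\}$-sublattice), universal (every finite $\{0,1\}$-lattice embeds into $K$), and ultrahomogeneous (for all finite $\{0,1\}$-lattices $A,B$ and embeddings $i:A\to B$, $j:A\to K$ there is an embedding $g:B\to K$ with $g\circ i=j$). Proposition. A typical countable $\{0,1\}$-lattice exists. Every typical countable $\{0,1\}$-lattice $K^*$ has the monotone interpolation property: for every $n$, every monotone function $f:(K^*)^n\to K^*$ and every finite $\{0,1\}$-sublattice $A\le K^*$ there is a lattice polynomial $p(x_1,\dots,x_n)$ with coefficients in $K^*$ such that $p(\vec a)=f(\vec a)$ for all $\vec a\in A^n$. Moreover $K^*$ is simple: the only congruence relations of $K^*$ are the equality relation and the total relation. -/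

import Mathlib

/-!
Throughout, a `{0,1}`-lattice is a lattice with a least element `⊥` (the constant `0`) and a
greatest element `⊤` (the constant `1`) with `⊥ ≠ ⊤`, that is, a type with instances of
`Lattice`, `BoundedOrder` and `Nontrivial`. Homomorphisms of `{0,1}`-lattices are
`BoundedLatticeHom`s (they preserve `⊔`, `⊓`, `⊥`, `⊤`).
-/

universe u

/-- A sublattice is a `{0,1}`-sublattice if it contains both constants. -/
def IsZeroOneSublattice {K : Type u} [Lattice K] [BoundedOrder K] (A : Sublattice K) : Prop :=
  ⊥ ∈ A ∧ ⊤ ∈ A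

/-- `K` is the typical `{0,1}`-lattice: the Fraïssé limit of the class of finite
`{0,1}`-lattices, i.e. the countable locally finite Fraïssé structure for this class. -/
structure IsTypicalZeroOneLattice (K : Type u) [Lattice K] [BoundedOrder K] : Prop where
  countable : Countable K
  /-- `0 ≠ 1`; equivalently, all finite substructures of `K` are (finite) `{0,1}`-lattices. -/
  nontrivial : Nontrivial K
  /-- Every finite set lies in a finite `{0,1}`-sublattice. -/
  locally_finite : ∀ s : Set K, s.Finite →
    ∃ A : Sublattice K, IsZeroOneSublattice A ∧ (A : Set K).Finite ∧ s ⊆ A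
  /-- Ultrahomogeneity: if `A` is a `{0,1}`-sublattice of a finite `{0,1}`-lattice `B` and of `K`,
  then `B` embeds into `K` over `A` (inclusions are written as embeddings). -/
  ultrahomogeneous : ∀ (A B : Type u) [Lattice A] [BoundedOrder A] [Nontrivial A] [Finite A]
    [Lattice B] [BoundedOrder B] [Nontrivial B] [Finite B]
    (i : BoundedLatticeHom A B) (j : BoundedLatticeHom A K),
    Function.Injective i → Function.Injective j →
    ∃ g : BoundedLatticeHom B K, Function.Injective g ∧ ∀ a, g (i a) = j a
  /-- Universality: every finite `{0,1}`-lattice embeds into `K`. -/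
  universal : ∀ (B : Type u) [Lattice B] [BoundedOrder B] [Nontrivial B] [Finite B],
    ∃ g : BoundedLatticeHom B K, Function.Injective g

/-- Lattice polynomials in `n` variables with coefficients in `K`. -/
inductive LatticePolynomial (K : Type u) (n : ℕ) : Type u
  | var (i : Fin n) : LatticePolynomial K n
  | const (c : K) : LatticePolynomial K n
  | sup (p q : LatticePolynomial K n) : LatticePolynomial K n
  | inf (p q : LatticePolynomial K n) : LatticePolynomial K n

/-- The function `K ^ n → K` induced by a lattice polynomial. -/
def LatticePolynomial.eval {K : Type u} [Lattice K] {n : ℕ} :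
    LatticePolynomial K n → (Fin n → K) → K
  | .var i, x => x i
  | .const c, _ => c
  | .sup p q, x => p.eval x ⊔ q.eval x
  | .inf p q, x => p.eval x ⊓ q.eval x

/-- The monotone interpolation property of a `{0,1}`-lattice `K`: every monotone function
`K ^ n → K` is induced by a lattice polynomial on every finite `{0,1}`-sublattice. -/
def MonotoneInterpolationProperty (K : Type u) [Lattice K] [BoundedOrder K] : Prop :=
  ∀ (n : ℕ) (f : (Fin n → K) → K), Monotone f →
    ∀ A : Sublattice K, IsZeroOneSublattice A → (A : Set K).Finite →
      ∃ p : LatticePolynomial K n, ∀ x : Fin n → K, (∀ i, x i ∈ A) → p.eval x = f x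

/-- A lattice with at least two elements is simple if its only congruence relations are the
equality relation and the total relation. -/
def IsSimpleLattice (K : Type u) [Lattice K] : Prop :=
  Nontrivial K ∧ ∀ c : LatticeCon K, (∀ x y, c.r x y → x = y) ∨ (∀ x y, c.r x y)

/-! Existence is Fraïssé's construction. Amalgamation (`exists_amalgam`) uses that an embedding of a
finite lattice has a meet-preserving upper adjoint: the fibre product of two such adjoints is a
lattice containing both extensions. Iterating amalgamation gives a finite extension solving all
problems of bounded size, and the limit of a chain of these is typical.

Both properties of a typical lattice rest on `exists_separating`: for `a ≰ b` the polynomial `((x ⊔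
c) ⊓ d) ⊔ ((x ⊔ c) ⊓ d')` sends `a` to `⊤` and `b` to `⊥`. A congruence identifying `a` and `b`
therefore identifies `⊤` and `⊥`. Meets of such polynomials act on a finite sublattice as indicators
of the up-sets `{x | a ≤ x}`, and a monotone `f` is the join over `a` of `f a` cut down by these
indicators. -/

/-- A finite meet-semilattice with a greatest element is a lattice. -/
noncomputable abbrev latticeOfFiniteSemilatticeInf (D : Type u) [SemilatticeInf D] [OrderTop D]
    [Finite D] : Lattice D :=
  letI := Fintype.ofFinite D
  letI : DecidableLE D := Classical.decRel _
  let upperBounds (x y : D) : Finset D := Finset.univ.filter fun s => x ≤ s ∧ y ≤ s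
  have mem (x y s : D) : s ∈ upperBounds x y ↔ x ≤ s ∧ y ≤ s := by simp [upperBounds]
  { ‹SemilatticeInf D› with
    sup := fun x y => (upperBounds x y).inf id
    le_sup_left := fun x y => Finset.le_inf fun s hs => ((mem x y s).1 hs).1
    le_sup_right := fun x y => Finset.le_inf fun s hs => ((mem x y s).1 hs).2
    sup_le := fun x y z hx hy => Finset.inf_le (f := id) ((mem x y z).2 ⟨hx, hy⟩) }

/-- A bundled finite `{0,1}`-lattice. -/
structure FiniteZeroOneLattice : Type (u + 1) where
  carrier : Type u
  [lattice : Lattice carrier]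
  [boundedOrder : BoundedOrder carrier]
  [nontrivial : Nontrivial carrier]
  [finite : Finite carrier]

instance : CoeSort FiniteZeroOneLattice.{u} (Type u) := ⟨FiniteZeroOneLattice.carrier⟩

attribute [instance] FiniteZeroOneLattice.lattice FiniteZeroOneLattice.boundedOrder
  FiniteZeroOneLattice.nontrivial FiniteZeroOneLattice.finite

/-- The finite `{0,1}`-lattice on a meet-closed subset, containing `⊥` and `⊤`, of a finite
lattice. Its order and its meets are the induced ones. -/
noncomputable def FiniteZeroOneLattice.ofInfClosed {P : Type u} [Lattice P] [BoundedOrder P]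
    [Nontrivial P] [Finite P] (S : Set P) (hbot : ⊥ ∈ S) (htop : ⊤ ∈ S) (hS : InfClosed S) :
    FiniteZeroOneLattice.{u} :=
  letI : SemilatticeInf S := Subtype.semilatticeInf fun _ _ hx hy => hS hx hy
  letI : OrderTop S := Subtype.orderTop htop
  letI : OrderBot S := Subtype.orderBot hbot
  { carrier := S
    lattice := latticeOfFiniteSemilatticeInf S
    boundedOrder :=
      { top := ⊤, bot := ⊥, le_top := fun _ => le_top, bot_le := fun _ => bot_le }
    nontrivial := ⟨⟨⟨⊥, hbot⟩, ⟨⊤, htop⟩, fun h => bot_ne_top (Subtype.ext_iff.1 h)⟩⟩ }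

/-- A meet-preserving map between lattices is a homomorphism if every upper bound of the images of
two elements bounds the image of their join. -/
def BoundedLatticeHom.ofInfHom {L M : Type*} [Lattice L] [BoundedOrder L] [Lattice M]
    [BoundedOrder M] (φ : L → M) (hbot : φ ⊥ = ⊥) (htop : φ ⊤ = ⊤)
    (hinf : ∀ x y, φ (x ⊓ y) = φ x ⊓ φ y)
    (hsup : ∀ x y s, φ x ≤ s → φ y ≤ s → φ (x ⊔ y) ≤ s) : BoundedLatticeHom L M where
  toFun := φ
  map_inf' := hinf
  map_sup' x y :=
    have hmono : Monotone φ := fun a b hab => by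
      rw [← inf_eq_left, ← hinf, inf_eq_left.2 hab]
    le_antisymm (hsup x y _ le_sup_left le_sup_right)
      (sup_le (hmono le_sup_left) (hmono le_sup_right))
  map_bot' := hbot
  map_top' := htop

/-! ### Amalgamation of finite lattices -/

section Amalgamation

variable {A B C : Type*} [Lattice A] [BoundedOrder A] [Lattice B] [BoundedOrder B]
  [Lattice C] [BoundedOrder C]

theorem BoundedLatticeHom.le_iff_of_injective {i : BoundedLatticeHom A B}
    (hi : Function.Injective i) {x y : A} : i x ≤ i y ↔ x ≤ y := by
  rw [← inf_eq_left, ← map_inf, hi.eq_iff, inf_eq_left]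

/-- A homomorphism from a finite `{0,1}`-lattice has an upper adjoint. -/
theorem BoundedLatticeHom.exists_galoisConnection [Finite A] (i : BoundedLatticeHom A B) :
    ∃ r : B → A, GaloisConnection i r := by
  classical
  have := Fintype.ofFinite A
  refine ⟨fun b => (Finset.univ.filter fun a => i a ≤ b).sup id, fun a b => ⟨fun h => ?_,
    fun h => ?_⟩⟩
  · exact Finset.le_sup (f := id) (by simpa using h)
  · refine (OrderHomClass.mono i h).trans ?_
    rw [map_finset_sup]
    exact Finset.sup_le fun s hs => by simpa using hs

/-- The upper adjoint of an embedding is a left inverse. -/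
theorem GaloisConnection.map_apply_of_injective {i : BoundedLatticeHom A B}
    (hi : Function.Injective i) {r : B → A} (h : GaloisConnection i r) (a : A) : r (i a) = a :=
  le_antisymm ((BoundedLatticeHom.le_iff_of_injective hi).1 (h.l_u_le _)) (h.le_u le_rfl)

end Amalgamation

/-- Finite `{0,1}`-lattices have the amalgamation property. -/
theorem exists_amalgam {A B C : Type u} [Lattice A] [BoundedOrder A] [Finite A]
    [Lattice B] [BoundedOrder B] [Nontrivial B] [Finite B]
    [Lattice C] [BoundedOrder C] [Finite C]
    (i : BoundedLatticeHom A B) (j : BoundedLatticeHom A C)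
    (hi : Function.Injective i) (hj : Function.Injective j) :
    ∃ (D : FiniteZeroOneLattice.{u}) (f : BoundedLatticeHom B D) (g : BoundedLatticeHom C D),
      Function.Injective f ∧ Function.Injective g ∧ ∀ a, f (i a) = g (j a) := by
  obtain ⟨r, hr⟩ := i.exists_galoisConnection
  obtain ⟨s, hs⟩ := j.exists_galoisConnection
  have hri := hr.map_apply_of_injective hi
  have hsj := hs.map_apply_of_injective hj
  have hr0 : r ⊥ = ⊥ := by rw [← map_bot i, hri]
  have hs0 : s ⊥ = ⊥ := by rw [← map_bot j, hsj]
  -- `(b, j (r b))` is the least point of `D` whose first coordinate lies above `b`, so `B` embeds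
  -- by a lower adjoint of the projection, which preserves joins; likewise for `C`.
  let D := FiniteZeroOneLattice.ofInfClosed {p : B × C | r p.1 = s p.2}
    (by simp [hr0, hs0]) (by simp [hr.u_top, hs.u_top])
    (fun p hp q hq => by
      simp only [Set.mem_ofPred_eq] at hp hq ⊢
      rw [Prod.fst_inf, Prod.snd_inf, hr.u_inf, hs.u_inf, hp, hq])
  refine ⟨D, BoundedLatticeHom.ofInfHom (fun b => ⟨(b, j (r b)), (hsj _).symm⟩) ?_ ?_ ?_ ?_,
    BoundedLatticeHom.ofInfHom (fun c => ⟨(i (s c), c), hri _⟩) ?_ ?_ ?_ ?_, ?_, ?_, ?_⟩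
  · exact Subtype.ext (Prod.ext rfl (by simp [hr0]; rfl))
  · exact Subtype.ext (Prod.ext rfl (by simp [hr.u_top]; rfl))
  · exact fun x y => Subtype.ext (Prod.ext rfl (by simp only [hr.u_inf, map_inf]; rfl))
  · rintro x y ⟨p, hp⟩ ⟨hx, hx'⟩ ⟨hy, hy'⟩
    have h : x ⊔ y ≤ p.1 := sup_le hx hy
    exact ⟨h, (hs _ _).2 ((hr.monotone_u h).trans_eq hp)⟩
  · exact Subtype.ext (Prod.ext (by simp [hs0]; rfl) rfl)
  · exact Subtype.ext (Prod.ext (by simp [hs.u_top]; rfl) rfl)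
  · exact fun x y => Subtype.ext (Prod.ext (by simp only [hs.u_inf, map_inf]; rfl) rfl)
  · rintro x y ⟨p, hp⟩ ⟨hx', hx⟩ ⟨hy', hy⟩
    have h : x ⊔ y ≤ p.2 := sup_le hx hy
    exact ⟨(hr _ _).2 ((hs.monotone_u h).trans_eq hp.symm), h⟩
  · exact fun x y h => congrArg (fun p : D => p.1.1) h
  · exact fun x y h => congrArg (fun p : D => p.1.2) h
  · exact fun a => Subtype.ext (Prod.ext (congrArg i (hsj a)).symm (congrArg j (hri a)))

/-! ### Separating two elements -/

/-- If `a ≰ b` in a finite `{0,1}`-lattice, then some finite extension has elements `c`, `d`, `d'`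
such that `x ↦ ((x ⊔ c) ⊓ d) ⊔ ((x ⊔ c) ⊓ d')` maps `a` to `⊤` and `b` to `⊥`. -/
theorem exists_separating_extension {L : Type u} [Lattice L] [BoundedOrder L] [Nontrivial L]
    [Finite L] {a b : L} (hab : ¬ a ≤ b) :
    ∃ (M : FiniteZeroOneLattice.{u}) (f : BoundedLatticeHom L M) (c d d' : M),
      Function.Injective f ∧ f a ⊔ c = ⊤ ∧ f b ≤ c ∧ c ⊓ d = ⊥ ∧ c ⊓ d' = ⊥ ∧ d ⊔ d' = ⊤ := by
  classical
  have hb : b ≠ ⊤ := fun h => hab (h ▸ le_top)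
  -- The three flags mark lying above `c`, `d`, `d'`. A pair of elements with no common upper bound
  -- in `Q` has join `⊤` in `Q ∪ {⊤}`. The second condition thus forces `a ⊔ c = ⊤`, the third `d ⊔
  -- d' = ⊤`.
  let Q : Set (L × Bool × Bool × Bool) :=
    {p | p.1 ≠ ⊤ ∧ (p.2.1 = true → p.1 ≤ b) ∧ (p.2.2.1 = true → p.2.2.2 = false)}
  have hQ : IsLowerSet Q := by
    rintro ⟨x, i, j, k⟩ ⟨y, i', j', k'⟩ ⟨h, hi, hj, hk⟩ ⟨hx, hc, hd⟩
    refine ⟨fun e => hx (top_le_iff.1 (e ▸ h)), fun e => h.trans (hc ?_), fun e => ?_⟩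
    · simpa using hi e
    · have := hd (hj e)
      exact Bool.eq_false_iff.2 fun e' => by simp_all [show k = true from hk e']
  let M := FiniteZeroOneLattice.ofInfClosed {p : L × Bool × Bool × Bool | p = ⊤ ∨ p ∈ Q}
    (Or.inr ⟨bot_ne_top, by simp, by simp⟩) (Or.inl rfl) (by
      rintro p (rfl | hp) q hq
      · rwa [top_inf_eq]
      · exact Or.inr (hQ inf_le_left hp))
  let φ (x : L) : M := if h : x = ⊤ then ⊤ else ⟨(x, ⊥), Or.inr ⟨h, by simp, by simp⟩⟩
  have hφ' {x : L} (h : x ≠ ⊤) : φ x = ⟨(x, ⊥), Or.inr ⟨h, by simp, by simp⟩⟩ := dif_neg h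
  have htop : φ ⊤ = ⊤ := dif_pos rfl
  have hφ (x : L) : (φ x).1.1 = x := by
    by_cases h : x = ⊤
    · rw [h, htop]; rfl
    · rw [hφ' h]
  let f : BoundedLatticeHom L M := BoundedLatticeHom.ofInfHom φ (hφ' bot_ne_top) htop
    (fun x y => by
      by_cases hx : x = ⊤
      · rw [hx, htop, top_inf_eq, top_inf_eq]
      by_cases hy : y = ⊤
      · rw [hy, htop, inf_top_eq, inf_top_eq]
      rw [hφ' hx, hφ' hy, hφ' fun h => hx (top_le_iff.1 (h ▸ inf_le_left))]
      exact Subtype.ext (Prod.ext rfl (inf_idem _).symm))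
    (by
      rintro x y ⟨p, rfl | hp⟩ hx hy
      · exact le_top
      have h : x ⊔ y ≤ p.1 := sup_le ((hφ x).symm.le.trans hx.1) ((hφ y).symm.le.trans hy.1)
      rw [hφ' fun e => hp.1 (top_le_iff.1 (e ▸ h))]
      exact ⟨h, bot_le⟩)
  let c : M := ⟨(b, true, false, false), Or.inr ⟨hb, by simp, by simp⟩⟩
  let d : M := ⟨(⊥, false, true, false), Or.inr ⟨bot_ne_top, by simp, by simp⟩⟩
  let d' : M := ⟨(⊥, false, false, true), Or.inr ⟨bot_ne_top, by simp, by simp⟩⟩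
  refine ⟨M, f, c, d, d', fun x y h => ?_, ?_, ?_, ?_, ?_, ?_⟩
  · rw [← hφ x, ← hφ y]
    exact congrArg (fun p : M => p.1.1) h
  · have h₁ : φ a ≤ φ a ⊔ c := le_sup_left
    have h₂ : c ≤ φ a ⊔ c := le_sup_right
    change φ a ⊔ c = ⊤
    generalize φ a ⊔ c = s at h₁ h₂
    obtain ⟨p, rfl | hp⟩ := s
    · rfl
    · exact (hab (((hφ a).symm.le.trans h₁.1).trans (hp.2.1 (h₂.2.1 rfl)))).elim
  · change φ b ≤ c
    rw [hφ' hb]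
    exact ⟨le_rfl, bot_le⟩
  · exact Subtype.ext (Prod.ext (inf_bot_eq b) rfl)
  · exact Subtype.ext (Prod.ext (inf_bot_eq b) rfl)
  · have h₁ : d ≤ d ⊔ d' := le_sup_left
    have h₂ : d' ≤ d ⊔ d' := le_sup_right
    generalize d ⊔ d' = s at h₁ h₂
    obtain ⟨p, rfl | hp⟩ := s
    · rfl
    · exact absurd (hp.2.2 (h₁.2.2.1 rfl)) (by simp [show p.2.2.2 = true from h₂.2.2.2 rfl])

namespace IsTypicalZeroOneLattice

variable {K : Type u} [Lattice K] [BoundedOrder K]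

/-- The witnesses exist in an extension of a finite sublattice containing `a` and `b`;
ultrahomogeneity places that extension in `K` over the sublattice. -/
theorem exists_separating (hK : IsTypicalZeroOneLattice K) {a b : K} (hab : ¬ a ≤ b) :
    ∃ c d d' : K, a ⊔ c = ⊤ ∧ b ≤ c ∧ c ⊓ d = ⊥ ∧ c ⊓ d' = ⊥ ∧ d ⊔ d' = ⊤ := by
  have := hK.nontrivial
  obtain ⟨A, ⟨hbot, htop⟩, hfin, hA⟩ := hK.locally_finite {a, b} (Set.toFinite _)
  have ha : a ∈ A := hA (by simp)
  have hb : b ∈ A := hA (by simp)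
  let _ : BoundedOrder A :=
    { top := ⟨⊤, htop⟩, bot := ⟨⊥, hbot⟩
      le_top := fun x => (le_top : x.1 ≤ ⊤), bot_le := fun x => (bot_le : ⊥ ≤ x.1) }
  have : Finite A := hfin
  have : Nontrivial A := ⟨⟨⊥, ⊤, fun h => bot_ne_top (α := K) (Subtype.ext_iff.1 h)⟩⟩
  let j : BoundedLatticeHom A K := { A.subtype with map_top' := rfl, map_bot' := rfl }
  obtain ⟨M, f, c, d, d', hf, h₁, h₂, h₃, h₄, h₅⟩ :=
    exists_separating_extension (L := A) (a := ⟨a, ha⟩) (b := ⟨b, hb⟩) hab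
  obtain ⟨g, -, hg⟩ := hK.ultrahomogeneous A M f j hf Subtype.val_injective
  have hga : g (f ⟨a, ha⟩) = a := hg _
  have hgb : g (f ⟨b, hb⟩) = b := hg _
  refine ⟨g c, g d, g d', ?_, ?_, ?_, ?_, ?_⟩
  · rw [← hga, ← map_sup, h₁, map_top]
  · rw [← hgb]
    exact OrderHomClass.mono g h₂
  · rw [← map_inf, h₃, map_bot]
  · rw [← map_inf, h₄, map_bot]
  · rw [← map_sup, h₅, map_top]

/-- A typical lattice is simple. -/
theorem isSimpleLattice (hK : IsTypicalZeroOneLattice K) : IsSimpleLattice K := by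
  refine ⟨hK.nontrivial, fun r => or_iff_not_imp_left.2 fun h => ?_⟩
  obtain ⟨a, b, hr, hab⟩ : ∃ a b, r.r a b ∧ ¬ a ≤ b := by
    by_contra! hle
    exact h fun x y hxy => le_antisymm (hle x y hxy) (hle y x (r.symm hxy))
  obtain ⟨c, d, d', h₁, h₂, h₃, h₄, h₅⟩ := hK.exists_separating hab
  -- The separating polynomial is applied to the pair `(a, b)` one operation at a time.
  have hc : r.r ⊤ c := by
    have := r.sup hr (r.refl c)
    rwa [h₁, sup_eq_right.2 h₂] at this
  have hcd {e : K} (he : c ⊓ e = ⊥) : r.r e ⊥ := by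
    have := r.inf hc (r.refl e)
    rwa [top_inf_eq, he] at this
  have htop : r.r ⊤ ⊥ := by
    have := r.sup (hcd h₃) (hcd h₄)
    rwa [h₅, sup_idem] at this
  have hbot (x : K) : r.r x ⊥ := by
    have := r.inf (r.refl x) htop
    rwa [inf_top_eq, inf_bot_eq] at this
  exact fun x y => r.trans (hbot x) (r.symm (hbot y))

end IsTypicalZeroOneLattice

/-! ### Monotone interpolation -/

section Interpolation

variable {K : Type u} [Lattice K] {n : ℕ}

/-- `h` is induced by a lattice polynomial. -/
def IsPolynomialFunction (h : (Fin n → K) → K) : Prop :=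
  ∃ p : LatticePolynomial K n, ∀ x, p.eval x = h x

namespace IsPolynomialFunction

theorem var (i : Fin n) : IsPolynomialFunction fun x : Fin n → K => x i := ⟨.var i, fun _ => rfl⟩

theorem const (c : K) : IsPolynomialFunction fun _ : Fin n → K => c := ⟨.const c, fun _ => rfl⟩

theorem sup {g h : (Fin n → K) → K} (hg : IsPolynomialFunction g) (hh : IsPolynomialFunction h) :
    IsPolynomialFunction fun x => g x ⊔ h x :=
  let ⟨p, hp⟩ := hg
  let ⟨q, hq⟩ := hh
  ⟨.sup p q, fun x => congrArg₂ _ (hp x) (hq x)⟩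

theorem inf {g h : (Fin n → K) → K} (hg : IsPolynomialFunction g) (hh : IsPolynomialFunction h) :
    IsPolynomialFunction fun x => g x ⊓ h x :=
  let ⟨p, hp⟩ := hg
  let ⟨q, hq⟩ := hh
  ⟨.inf p q, fun x => congrArg₂ _ (hp x) (hq x)⟩

theorem finset_sup [BoundedOrder K] {ι : Type*} (s : Finset ι) {h : ι → (Fin n → K) → K}
    (hh : ∀ i, IsPolynomialFunction (h i)) :
    IsPolynomialFunction fun x => s.sup fun i => h i x := by
  classical
  induction s using Finset.induction_on with
  | empty => simpa using const ⊥
  | insert i s _ ih => simpa using (hh i).sup ih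

theorem finset_inf [BoundedOrder K] {ι : Type*} (s : Finset ι) {h : ι → (Fin n → K) → K}
    (hh : ∀ i, IsPolynomialFunction (h i)) :
    IsPolynomialFunction fun x => s.inf fun i => h i x := by
  classical
  induction s using Finset.induction_on with
  | empty => simpa using const ⊤
  | insert i s _ ih => simpa using (hh i).inf ih

end IsPolynomialFunction

/-- A typical lattice has the monotone interpolation property. -/
theorem IsTypicalZeroOneLattice.monotoneInterpolationProperty [BoundedOrder K]
    (hK : IsTypicalZeroOneLattice K) : MonotoneInterpolationProperty K := by
  classical
  intro n f hf A _ hA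
  have : Fintype A := hA.fintype
  have hq (a b : K) : ∃ q : K → K,
      (∀ i : Fin n, IsPolynomialFunction fun x : Fin n → K => q (x i)) ∧
        (¬ a ≤ b → q a = ⊤ ∧ q b = ⊥) := by
    -- The identity is a dummy value: only pairs with `a ≰ b` enter the interpolant.
    by_cases hab : a ≤ b
    · exact ⟨id, .var, fun h => (h hab).elim⟩
    obtain ⟨c, d, d', h₁, h₂, h₃, h₄, h₅⟩ := hK.exists_separating hab
    refine ⟨fun x => ((x ⊔ c) ⊓ d) ⊔ ((x ⊔ c) ⊓ d'), fun i => ?_, fun _ => ⟨?_, ?_⟩⟩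
    · exact (((IsPolynomialFunction.var i).sup (.const c)).inf (.const d)).sup
        (((IsPolynomialFunction.var i).sup (.const c)).inf (.const d'))
    · simp [h₁, h₅]
    · simp [sup_eq_right.2 h₂, h₃, h₄]
  choose q hpoly hq using hq
  let t (a : Fin n → A) (i : Fin n) : Finset A := Finset.univ.filter fun b => ¬ (a i : K) ≤ b
  obtain ⟨p, hp⟩ : IsPolynomialFunction fun x : Fin n → K =>
      (Finset.univ : Finset (Fin n → A)).sup fun a => f (fun i => a i) ⊓
        (Finset.univ : Finset (Fin n)).inf fun i => (t a i).inf fun b => q (a i) b (x i) :=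
    .finset_sup _ fun a => (IsPolynomialFunction.const _).inf <|
      .finset_inf _ fun i => .finset_inf _ fun b => hpoly _ _ i
  refine ⟨p, fun x hx => (hp x).trans (le_antisymm (Finset.sup_le fun a _ => ?_) ?_)⟩
  -- The term at `a` is at most `f a ≤ f x` if `a ≤ x`; otherwise the factor with `b = x i` kills
  -- it.
  · by_cases hax : ∀ i, (a i : K) ≤ x i
    · exact inf_le_left.trans (hf hax)
    obtain ⟨i, hi⟩ := not_forall.1 hax
    have hmem : (⟨x i, hx i⟩ : A) ∈ t a i := Finset.mem_filter.2 ⟨Finset.mem_univ _, hi⟩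
    refine inf_le_right.trans ((Finset.inf_le (Finset.mem_univ i)).trans
      ((Finset.inf_le hmem).trans ?_))
    rw [(hq _ _ hi).2]
    exact bot_le
  -- In the term at `a = x` every indicator factor is `⊤`, so the term equals `f x`.
  · refine le_trans (le_inf le_rfl (Finset.le_inf fun i _ => Finset.le_inf fun b hb => ?_))
      (Finset.le_sup (f := fun a : Fin n → A => f (fun i => a i) ⊓
        (Finset.univ : Finset (Fin n)).inf fun i => (t a i).inf fun b => q (a i) b (x i))
        (Finset.mem_univ fun i => (⟨x i, hx i⟩ : A)))
    rw [(hq (x i) b (Finset.mem_filter.1 hb).2).1]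
    exact le_top

end Interpolation

/-! ### Solving all extension problems of bounded size -/

section Extension

/-- A description, up to isomorphism of `B`, of a diagram `B ← A → L` with `B` of at most `n`
elements: the order of `B` and the partial map from `B` to `L`. -/
abbrev AmalgamationTask (L : Type u) (n : ℕ) : Type u :=
  Σ m : Fin (n + 1), (Fin m → Fin m → Prop) × (Fin m → L → Prop)

/-- The task `t` describes the diagram given by `i` and `j`. -/
def AmalgamationTask.Describes {L : Type u} {n : ℕ} (t : AmalgamationTask L n)
    {A B : Type u} [LE B] (i : A → B) (j : A → L) : Prop :=
  ∃ e : B ≃ Fin t.1, (∀ x y, t.2.1 (e x) (e y) ↔ x ≤ y) ∧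
    ∀ x l, t.2.2 (e x) l ↔ ∃ a, i a = x ∧ j a = l

theorem AmalgamationTask.exists_describes {L : Type u} {n : ℕ} {A B : Type u} [LE B] [Finite B]
    (hB : Nat.card B ≤ n) (i : A → B) (j : A → L) :
    ∃ t : AmalgamationTask L n, t.Describes i j := by
  let e : B ≃ Fin (Nat.card B) := Finite.equivFin B
  refine ⟨⟨⟨Nat.card B, Nat.lt_succ_of_le hB⟩, fun x y => e.symm x ≤ e.symm y,
    fun x l => ∃ a, i a = e.symm x ∧ j a = l⟩, e, ?_, ?_⟩ <;> simp

/-- Every diagram described by `t` is completed by `N` over `f`. -/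
def AmalgamationTask.SolvedBy {L : Type u} [Lattice L] [BoundedOrder L] {n : ℕ}
    (t : AmalgamationTask L n) {N : Type u} [Lattice N] [BoundedOrder N]
    (f : BoundedLatticeHom L N) : Prop :=
  ∀ (A B : FiniteZeroOneLattice.{u}) (i : BoundedLatticeHom A B) (j : BoundedLatticeHom A L),
    Function.Injective i → Function.Injective j → t.Describes i j →
    ∃ g : BoundedLatticeHom B N, Function.Injective g ∧ ∀ a, g (i a) = f (j a)

theorem AmalgamationTask.SolvedBy.comp {L : Type u} [Lattice L] [BoundedOrder L] {n : ℕ}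
    {t : AmalgamationTask L n} {N N' : Type u} [Lattice N] [BoundedOrder N]
    [Lattice N'] [BoundedOrder N'] {f : BoundedLatticeHom L N} (ht : t.SolvedBy f)
    {h : BoundedLatticeHom N N'} (hh : Function.Injective h) : t.SolvedBy (h.comp f) := by
  intro A B i j hi hj hd
  obtain ⟨g, hg, hgi⟩ := ht A B i j hi hj hd
  exact ⟨h.comp g, hh.comp hg, fun a => congrArg h (hgi a)⟩

/-- One amalgamation suffices for each task: two diagrams with the same description differ by an
isomorphism of their `B`s compatible with the partial maps to `L`. As tasks over a finite `L` form a
finite type, they can be solved in succession. -/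
theorem AmalgamationTask.exists_solvedBy {L : Type u} [Lattice L] [BoundedOrder L] {n : ℕ}
    (t : AmalgamationTask L n) {N : FiniteZeroOneLattice.{u}} {f : BoundedLatticeHom L N}
    (hf : Function.Injective f) :
    ∃ (N' : FiniteZeroOneLattice.{u}) (h : BoundedLatticeHom N N'),
      Function.Injective h ∧ t.SolvedBy (h.comp f) := by
  by_cases ht : ∃ (A B : FiniteZeroOneLattice.{u}) (i : BoundedLatticeHom A B)
      (j : BoundedLatticeHom A L),
      Function.Injective i ∧ Function.Injective j ∧ t.Describes i j
  · obtain ⟨A, B, i, j, hi, hj, e, hle, hij⟩ := ht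
    obtain ⟨D, g, h, hg, hh, hgh⟩ := exists_amalgam i (f.comp j) hi (hf.comp hj)
    refine ⟨D, h, hh, ?_⟩
    rintro A' B' i' j' - - ⟨e', hle', hij'⟩
    let o : B' ≃o B :=
      { toEquiv := e'.trans e.symm
        map_rel_iff' := fun {x y} => by rw [← hle, ← hle']; simp }
    refine ⟨g.comp (o : BoundedLatticeHom B' B), hg.comp o.injective, fun a' => ?_⟩
    have heo (x : B') : e (o x) = e' x := e.apply_symm_apply _
    obtain ⟨a, ha, ha'⟩ := (hij (o (i' a')) (j' a')).1 <| by
      rw [heo]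
      exact (hij' _ _).2 ⟨a', rfl, rfl⟩
    have := hgh a
    rw [ha] at this
    exact this.trans (congrArg (fun x => h (f x)) ha')
  · exact ⟨N, BoundedLatticeHom.id N, Function.injective_id, fun A B i j hi hj hd =>
      (ht ⟨A, B, i, j, hi, hj, hd⟩).elim⟩

/-- Every finite `{0,1}`-lattice has a finite extension over which all extension problems of
bounded size can be solved. -/
theorem FiniteZeroOneLattice.exists_extension (L : FiniteZeroOneLattice.{u}) (n : ℕ) :
    ∃ (N : FiniteZeroOneLattice.{u}) (f : BoundedLatticeHom L N), Function.Injective f ∧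
      ∀ (A B : FiniteZeroOneLattice.{u}) (i : BoundedLatticeHom A B) (j : BoundedLatticeHom A L),
        Nat.card B ≤ n → Function.Injective i → Function.Injective j →
        ∃ g : BoundedLatticeHom B N, Function.Injective g ∧ ∀ a, g (i a) = f (j a) := by
  classical
  have key (s : Finset (AmalgamationTask L n)) : ∃ (N : FiniteZeroOneLattice.{u})
      (f : BoundedLatticeHom L N), Function.Injective f ∧ ∀ t ∈ s, t.SolvedBy f := by
    induction s using Finset.induction_on with
    | empty => exact ⟨L, BoundedLatticeHom.id L, Function.injective_id, by simp⟩
    | insert t s _ ih =>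
      obtain ⟨N, f, hf, hs⟩ := ih
      obtain ⟨N', h, hh, ht⟩ := t.exists_solvedBy hf
      refine ⟨N', h.comp f, hh.comp hf, fun t' ht' => ?_⟩
      obtain rfl | ht' := Finset.mem_insert.1 ht'
      · exact ht
      · exact (hs t' ht').comp hh
  have := Fintype.ofFinite (AmalgamationTask L n)
  obtain ⟨N, f, hf, h⟩ := key Finset.univ
  refine ⟨N, f, hf, fun A B i j hB hi hj => ?_⟩
  obtain ⟨t, ht⟩ := AmalgamationTask.exists_describes hB i j
  exact h t (Finset.mem_univ t) A B i j hi hj ht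

end Extension

/-! ### Direct limits of bounded lattices -/

section DirectLimit

variable {ι : Type*} [Preorder ι] [IsDirectedOrder ι] {G : ι → Type*}
  [∀ i, Lattice (G i)] [∀ i, BoundedOrder (G i)]
  (f : ∀ i j, i ≤ j → BoundedLatticeHom (G i) (G j)) [DirectedSystem G (f · · ·)]

/-- The direct limit of a directed system of bounded lattices. This is a type synonym, which avoids
the order that a quotient inherits from the order of the sigma type. -/
def LatticeDirectLimit : Type _ := DirectLimit G (f · · ·)

namespace LatticeDirectLimit

/-- The canonical map to the direct limit. -/
def mk (i : ι) (x : G i) : LatticeDirectLimit f := (⟦⟨i, x⟩⟧ : DirectLimit G (f · · ·))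

theorem exists_eq_mk (x : LatticeDirectLimit f) : ∃ i y, x = mk f i y :=
  DirectLimit.exists_eq_mk _ x

theorem exists_eq_mk₂ (x y : LatticeDirectLimit f) : ∃ i u v, x = mk f i u ∧ y = mk f i v :=
  DirectLimit.exists_eq_mk₂ _ x y

theorem exists_eq_mk₃ (x y z : LatticeDirectLimit f) :
    ∃ i u v w, x = mk f i u ∧ y = mk f i v ∧ z = mk f i w :=
  DirectLimit.exists_eq_mk₃ _ x y z

theorem mk_map {i j : ι} (h : i ≤ j) (x : G i) : mk f j (f i j h x) = mk f i x :=
  DirectLimit.mk_apply (f := (f · · ·)) i j x h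

noncomputable instance : Max (LatticeDirectLimit f) where
  max := DirectLimit.map₂ (f · · ·) (f · · ·) (f · · ·) (fun _ x y => x ⊔ y)
    fun _ _ _ _ _ => map_sup _ _ _

noncomputable instance : Min (LatticeDirectLimit f) where
  min := DirectLimit.map₂ (f · · ·) (f · · ·) (f · · ·) (fun _ x y => x ⊓ y)
    fun _ _ _ _ _ => map_inf _ _ _

theorem mk_sup (i) (x y : G i) : mk f i (x ⊔ y) = mk f i x ⊔ mk f i y :=
  (DirectLimit.map₂_def (f · · ·) (f · · ·) (f · · ·) (fun _ x y => x ⊔ y) _ i x y).symm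

theorem mk_inf (i) (x y : G i) : mk f i (x ⊓ y) = mk f i x ⊓ mk f i y :=
  (DirectLimit.map₂_def (f · · ·) (f · · ·) (f · · ·) (fun _ x y => x ⊓ y) _ i x y).symm

noncomputable instance : Lattice (LatticeDirectLimit f) :=
  Lattice.mk'
    (fun x y => by
      obtain ⟨i, x, y, rfl, rfl⟩ := exists_eq_mk₂ f x y
      rw [← mk_sup, sup_comm, mk_sup])
    (fun x y z => by
      obtain ⟨i, x, y, z, rfl, rfl, rfl⟩ := exists_eq_mk₃ f x y z
      simp only [← mk_sup, sup_assoc])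
    (fun x y => by
      obtain ⟨i, x, y, rfl, rfl⟩ := exists_eq_mk₂ f x y
      rw [← mk_inf, inf_comm, mk_inf])
    (fun x y z => by
      obtain ⟨i, x, y, z, rfl, rfl, rfl⟩ := exists_eq_mk₃ f x y z
      simp only [← mk_inf, inf_assoc])
    (fun x y => by
      obtain ⟨i, x, y, rfl, rfl⟩ := exists_eq_mk₂ f x y
      rw [← mk_inf, ← mk_sup, sup_inf_self])
    (fun x y => by
      obtain ⟨i, x, y, rfl, rfl⟩ := exists_eq_mk₂ f x y
      rw [← mk_sup, ← mk_inf, inf_sup_self])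

variable [Nonempty ι]

noncomputable instance : Top (LatticeDirectLimit f) where
  top := DirectLimit.map₀ (f · · ·) fun _ => ⊤

noncomputable instance : Bot (LatticeDirectLimit f) where
  bot := DirectLimit.map₀ (f · · ·) fun _ => ⊥

theorem mk_top (i) : mk f i ⊤ = ⊤ :=
  (DirectLimit.map₀_def _ _ (fun _ _ _ => map_top _) i).symm

theorem mk_bot (i) : mk f i ⊥ = ⊥ :=
  (DirectLimit.map₀_def _ _ (fun _ _ _ => map_bot _) i).symm

noncomputable instance : BoundedOrder (LatticeDirectLimit f) where
  le_top x := by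
    obtain ⟨i, x, rfl⟩ := exists_eq_mk f x
    rw [← sup_eq_right, ← mk_top f i]
    exact (mk_sup f i x ⊤).symm.trans (congrArg (mk f i) (sup_top_eq x))
  bot_le x := by
    obtain ⟨i, x, rfl⟩ := exists_eq_mk f x
    rw [← sup_eq_right, ← mk_bot f i]
    exact (mk_sup f i ⊥ x).symm.trans (congrArg (mk f i) (bot_sup_eq x))

/-- The canonical homomorphism to the direct limit of bounded lattices. -/
noncomputable def of (i : ι) : BoundedLatticeHom (G i) (LatticeDirectLimit f) where
  toFun := mk f i
  map_sup' := mk_sup f i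
  map_inf' := mk_inf f i
  map_top' := mk_top f i
  map_bot' := mk_bot f i

theorem of_injective (hf : ∀ i j h, Function.Injective (f i j h)) (i : ι) :
    Function.Injective (of f i) :=
  DirectLimit.mk_injective (f · · ·) hf i

end LatticeDirectLimit

end DirectLimit

/-- A homomorphism whose values lie in the range of an embedding factors through it. -/
theorem BoundedLatticeHom.exists_comp_eq {A B C : Type*} [Lattice A] [BoundedOrder A]
    [Lattice B] [BoundedOrder B] [Lattice C] [BoundedOrder C] (j : BoundedLatticeHom A C)
    {h : BoundedLatticeHom B C} (hh : Function.Injective h) (hr : Set.range j ⊆ Set.range h) :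
    ∃ k : BoundedLatticeHom A B, ∀ a, h (k a) = j a := by
  choose k hk using fun a => hr (Set.mem_range_self a)
  exact ⟨{ toFun := k
           map_sup' := fun x y => hh (by simp only [hk, map_sup])
           map_inf' := fun x y => hh (by simp only [hk, map_inf])
           map_top' := hh (by simp only [hk, map_top])
           map_bot' := hh (by simp only [hk, map_bot]) }, hk⟩

/-- The homomorphism from the two-element lattice. -/
def BoundedLatticeHom.ofULiftBool (B : Type*) [Lattice B] [BoundedOrder B] :
    BoundedLatticeHom (ULift.{u} Bool) B where
  toFun b := if b.down then ⊤ else ⊥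
  map_sup' := by rintro ⟨_ | _⟩ ⟨_ | _⟩ <;> simp
  map_inf' := by rintro ⟨_ | _⟩ ⟨_ | _⟩ <;> simp
  map_top' := by simp
  map_bot' := by simp

theorem BoundedLatticeHom.ofULiftBool_injective (B : Type*) [Lattice B] [BoundedOrder B]
    [Nontrivial B] : Function.Injective (BoundedLatticeHom.ofULiftBool.{u} B) := by
  rintro ⟨_ | _⟩ ⟨_ | _⟩ <;> simp [ofULiftBool, bot_ne_top, top_ne_bot]

/-! ### The chain of finite lattices and its limit -/

section Chain

variable {L : ℕ → Type u} [∀ n, Lattice (L n)] [∀ n, BoundedOrder (L n)]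

/-- The transition homomorphisms of a chain of bounded lattices. -/
def BoundedLatticeHom.leRec (f : ∀ n, BoundedLatticeHom (L n) (L (n + 1))) (m n : ℕ)
    (h : m ≤ n) : BoundedLatticeHom (L m) (L n) where
  toFun := Nat.leRecOn h fun {k} => f k
  map_sup' x y := by
    induction n, h using Nat.le_induction with
    | base => simp only [Nat.leRecOn_self]
    | succ n h ih => simp only [Nat.leRecOn_succ h, ih, map_sup]
  map_inf' x y := by
    induction n, h using Nat.le_induction with
    | base => simp only [Nat.leRecOn_self]
    | succ n h ih => simp only [Nat.leRecOn_succ h, ih, map_inf]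
  map_top' := by
    induction n, h using Nat.le_induction with
    | base => simp only [Nat.leRecOn_self]
    | succ n h ih => simp only [Nat.leRecOn_succ h, ih, map_top]
  map_bot' := by
    induction n, h using Nat.le_induction with
    | base => simp only [Nat.leRecOn_self]
    | succ n h ih => simp only [Nat.leRecOn_succ h, ih, map_bot]

variable (f : ∀ n, BoundedLatticeHom (L n) (L (n + 1)))

instance : DirectedSystem L (BoundedLatticeHom.leRec f · · ·) where
  map_self _ _ := Nat.leRecOn_self _
  map_map _ _ _ hij hjk x := (Nat.leRecOn_trans hij hjk x).symm

theorem BoundedLatticeHom.leRec_injective (hf : ∀ n, Function.Injective (f n)) (m n : ℕ)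
    (h : m ≤ n) : Function.Injective (BoundedLatticeHom.leRec f m n h) :=
  Nat.leRecOn_injective h _ hf

theorem BoundedLatticeHom.leRec_succ (n : ℕ) (x : L n) :
    BoundedLatticeHom.leRec f n (n + 1) n.le_succ x = f n x :=
  Nat.leRecOn_succ' x

end Chain

/-- A chain of finite `{0,1}`-lattices in which the `n`-th step solves all extension problems of
size at most `n`. -/
theorem FiniteZeroOneLattice.exists_chain :
    ∃ (L : ℕ → FiniteZeroOneLattice.{u}) (f : ∀ n, BoundedLatticeHom (L n) (L (n + 1))),
      (∀ n, Function.Injective (f n)) ∧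
      ∀ n (A B : FiniteZeroOneLattice.{u}) (i : BoundedLatticeHom A B)
        (j : BoundedLatticeHom A (L n)),
        Nat.card B ≤ n → Function.Injective i → Function.Injective j →
        ∃ g : BoundedLatticeHom B (L (n + 1)), Function.Injective g ∧ ∀ a, g (i a) = f n (j a) := by
  choose next e he hext using FiniteZeroOneLattice.exists_extension.{u}
  let L : ℕ → FiniteZeroOneLattice.{u} := fun n => Nat.rec ⟨ULift.{u} Bool⟩ (fun n L => next L n) n
  exact ⟨L, fun n => (e (L n) n :), fun n => he (L n) n, fun n => hext (L n) n⟩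

/-- A typical countable `{0,1}`-lattice exists. -/
theorem exists_isTypicalZeroOneLattice :
    ∃ (K : Type u) (_ : Lattice K) (_ : BoundedOrder K), IsTypicalZeroOneLattice K := by
  obtain ⟨L, f, hf, hext⟩ := FiniteZeroOneLattice.exists_chain.{u}
  let G (n : ℕ) : Type u := L n
  let F : ∀ m n, m ≤ n → BoundedLatticeHom (G m) (G n) := BoundedLatticeHom.leRec (L := G) f
  have hF : ∀ m n h, Function.Injective (F m n h) := BoundedLatticeHom.leRec_injective (L := G) f hf
  let K : Type u := LatticeDirectLimit F
  let of (n : ℕ) : BoundedLatticeHom (L n) K := LatticeDirectLimit.of F n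
  have of_injective (n : ℕ) : Function.Injective (of n) :=
    LatticeDirectLimit.of_injective F hF n
  have of_map {m n : ℕ} (h : m ≤ n) (x : L m) : of n (F m n h x) = of m x :=
    LatticeDirectLimit.mk_map F h x
  have of_succ (n : ℕ) (x : L n) : of (n + 1) (f n x) = of n x := by
    rw [← of_map n.le_succ]
    exact congrArg _ (BoundedLatticeHom.leRec_succ (L := G) f n x).symm
  have range_mono {m n : ℕ} (h : m ≤ n) : Set.range (of m) ⊆ Set.range (of n) := by
    rintro _ ⟨x, rfl⟩
    exact ⟨F m n h x, of_map h x⟩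
  have exists_range (s : Set K) (hs : s.Finite) (k : ℕ) : ∃ n, k ≤ n ∧ s ⊆ Set.range (of n) := by
    induction s, hs using Set.Finite.induction_on with
    | empty => exact ⟨k, le_rfl, Set.empty_subset _⟩
    | @insert x s _ _ ih =>
      obtain ⟨n, hkn, hn⟩ := ih
      obtain ⟨m, y, rfl⟩ := LatticeDirectLimit.exists_eq_mk F x
      exact ⟨max m n, hkn.trans (le_max_right _ _), Set.insert_subset
        (range_mono (le_max_left _ _) ⟨y, rfl⟩) (hn.trans (range_mono (le_max_right _ _)))⟩
  have homogeneous (A B : Type u) [Lattice A] [BoundedOrder A] [Nontrivial A] [Finite A]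
      [Lattice B] [BoundedOrder B] [Nontrivial B] [Finite B]
      (i : BoundedLatticeHom A B) (j : BoundedLatticeHom A K) (hi : Function.Injective i)
      (hj : Function.Injective j) :
      ∃ g : BoundedLatticeHom B K, Function.Injective g ∧ ∀ a, g (i a) = j a := by
    -- The stage must contain the image of `j` and also be at least `Nat.card B`, so that the next
    -- stage solves this problem.
    obtain ⟨n, hn, hr⟩ := exists_range (Set.range j) (Set.finite_range j) (Nat.card B)
    obtain ⟨k, hk⟩ := j.exists_comp_eq (of_injective n) hr
    have hk' : Function.Injective k := fun x y h => hj (by rw [← hk, ← hk, h])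
    obtain ⟨g, hg, hgi⟩ := hext n ⟨A⟩ ⟨B⟩ i k hn hi hk'
    exact ⟨(of (n + 1)).comp g, (of_injective (n + 1)).comp hg, fun a =>
      (congrArg (of (n + 1)) (hgi a)).trans ((of_succ n (k a)).trans (hk a))⟩
  have : Nontrivial K := (of_injective 0).nontrivial
  refine ⟨K, inferInstance, inferInstance, ?_, this, fun s hs => ?_, homogeneous, fun B _ _ _ _ => ?_⟩
  · have (n : ℕ) : Countable (G n) := inferInstanceAs (Countable (L n))
    exact inferInstanceAs (Countable (Quotient _))
  · obtain ⟨n, -, hn⟩ := exists_range s hs 0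
    let A : Sublattice K :=
      { carrier := Set.range (of n)
        supClosed' := by
          rintro _ ⟨x, rfl⟩ _ ⟨y, rfl⟩
          exact ⟨x ⊔ y, map_sup _ _ _⟩
        infClosed' := by
          rintro _ ⟨x, rfl⟩ _ ⟨y, rfl⟩
          exact ⟨x ⊓ y, map_inf _ _ _⟩ }
    exact ⟨A, ⟨⟨⊥, map_bot _⟩, ⟨⊤, map_top _⟩⟩, Set.finite_range (of n), hn⟩
  -- Universality is the extension property over the two-element lattice, which embeds in both `B`
  -- and `K`.
  · obtain ⟨g, hg, -⟩ := homogeneous (ULift.{u} Bool) B (.ofULiftBool B) (.ofULiftBool K)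
      (BoundedLatticeHom.ofULiftBool_injective B) (BoundedLatticeHom.ofULiftBool_injective K)
    exact ⟨g, hg⟩

theorem mainTheorem6 :
    (∃ (K : Type u) (_ : Lattice K) (_ : BoundedOrder K), IsTypicalZeroOneLattice K) ∧
    ∀ (K : Type u) [Lattice K] [BoundedOrder K], IsTypicalZeroOneLattice K →
      MonotoneInterpolationProperty K ∧ IsSimpleLattice K :=
  ⟨exists_isTypicalZeroOneLattice, fun _ _ _ hK =>
    ⟨hK.monotoneInterpolationProperty, hK.isSimpleLattice⟩⟩
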